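/- Let $F$ be any field. Forms are homogeneous polynomials (as formal polynomials) over $F$. For a form $f$ of degree $d\ge 2$, a slice rank decomposition of $f$ with $r$ summands is a pair $(\vec\alpha,\vec g)$ of linear forms $\alpha_1,\dots,\alpha_r$ and forms $g_1,\dots,g_r$ of degree $d-1$ (the zero polynomial being allowed in both cases) with $f=\sum_{i=1}^r\alpha_i g_i$; the slice rank of $f$ is the least such $r$. Among the decompositions of $f$ with $r$ summands, let $\lesssim$ be the preorder generated by the following rules. 1. (Linear reduction) If $\beta_1,\dots,\beta_r$ are linear forms, $\alpha_i=\sum_{j} c_{i,j}\beta_j$ with $c_{i,j}\in F$, and $h_j=\sum_{i} c_{i,j}g_i$, then $(\vec\beta,\vec h)\lesssim(\vec\alpha,\vec g)$. 2. (Syzygy reduction) If $(q_{i,j})$ is an $r\times r$ matrix of forms of degree $d-2$ (possibly zero) with $q_{i,i}=0$ and $q_{i,j}=-q_{j,i}$, and $h_i=g_i-\sum_{j\ne i}q_{i,j}\alpha_j$, then $(\vec\alpha,\vec h)\lesssim(\vec\alpha,\vec g)$. 3. (Symmetric reduction) If $A$ is a linear endomorphism of the vector space $F^N$ on which the forms are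 defined ($N$ the number of variables) with $f\circ A=f$ (as polynomials), then $(\vec\alpha\circ A,\vec g\circ A)\lesssim(\vec\alpha,\vec g)$. Two decompositions are equivalent if each is $\lesssim$ the other. Theorem. For every $n\ge 2$, the slice rank of the determinant polynomial $\det_n$ in the $n^2$ variables $x_{i,j}$ is exactly $n$. Moreover, every slice rank decomposition $\det_n=\sum_{i=1}^n\alpha_i g_i$ with $n$ summands is equivalent to the Laplace expansion along the first row, $\det_n=\sum_{j=1}^n x_{1,j}\cdot(-1)^{1+j}M_{1,j}$, where $M_{1,j}$ is the minor of the generic matrix $(x_{i,j})$ with row $1$ and column $j$ removed. -/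

import Mathlib

open MvPolynomial

/-- A slice rank decomposition with `r` summands of `f`, where `f` is a form of degree `d` in the
variables `σ`: linear forms `α i` and forms `g i` of degree `d - 1` with `f = ∑ i, α i * g i`.
(Used only for `d ≥ 2`, so that the truncated subtractions `d - 1` and `d - 2` are genuine.
Forms are formal polynomials, also over finite fields.) -/
@[ext]
structure SliceDecomp {F σ : Type*} [Field F] (f : MvPolynomial σ F) (d r : ℕ) where
  α : Fin r → MvPolynomial σ F
  g : Fin r → MvPolynomial σ F
  α_linear : ∀ i, (α i).IsHomogeneous 1
  g_form : ∀ i, (g i).IsHomogeneous (d - 1)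
  sum_eq : f = ∑ i, α i * g i

/-- The slice rank of a form `f` of degree `d`: the least number of summands of a slice rank
decomposition (`⊤` if there is none). -/
noncomputable def sliceRank {F σ : Type*} [Field F] (f : MvPolynomial σ F) (d : ℕ) : ℕ∞ :=
  ⨅ (r : ℕ) (_ : Nonempty (SliceDecomp f d r)), (r : ℕ∞)

/-- `compLinear A p` is the polynomial `p ∘ A`, where `A` is a linear endomorphism of the space
`σ → F` given by its matrix: the variable `X i` is replaced by `∑ j, A i j * X j`. -/
noncomputable def compLinear {F σ : Type*} [Field F] [Fintype σ] (A : Matrix σ σ F)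
    (p : MvPolynomial σ F) : MvPolynomial σ F :=
  aeval (fun i => ∑ j, C (A i j) * X j) p

namespace SliceDecomp

/-- `Reduces D E` says that the decomposition `E` arises from `D` by one elementary reduction. -/
inductive Reduces {F σ : Type*} [Field F] [Fintype σ] {f : MvPolynomial σ F} {d r : ℕ} :
    SliceDecomp f d r → SliceDecomp f d r → Prop
  /-- Linear reduction: the old linear forms are written in terms of the new ones. -/
  | linear (D E : SliceDecomp f d r) (c : Matrix (Fin r) (Fin r) F)
      (hα : ∀ i, D.α i = ∑ j, C (c i j) * E.α j)
      (hg : ∀ j, E.g j = ∑ i, C (c i j) * D.g i) : Reduces D E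
  /-- Syzygy reduction, by an alternating matrix of forms of degree `d - 2`. -/
  | syzygy (D E : SliceDecomp f d r) (q : Matrix (Fin r) (Fin r) (MvPolynomial σ F))
      (hq_form : ∀ i j, (q i j).IsHomogeneous (d - 2))
      (hq_diag : ∀ i, q i i = 0) (hq_skew : ∀ i j, q i j = -q j i)
      (hα : ∀ i, E.α i = D.α i)
      (hg : ∀ i, E.g i = D.g i - ∑ j ∈ Finset.univ.erase i, q i j * D.α j) : Reduces D E
  /-- Symmetric reduction, by a linear map `A` with `f ∘ A = f`. -/
  | symmetric (D E : SliceDecomp f d r) (A : Matrix σ σ F) (hA : compLinear A f = f)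
      (hα : ∀ i, E.α i = compLinear A (D.α i))
      (hg : ∀ i, E.g i = compLinear A (D.g i)) : Reduces D E

/-- `Below E D` (usually written `E ≲ D`) is the preorder generated by the reductions: `E` is
obtained from `D` by finitely many of them. -/
def Below {F σ : Type*} [Field F] [Fintype σ] {f : MvPolynomial σ F} {d r : ℕ}
    (E D : SliceDecomp f d r) : Prop :=
  Relation.ReflTransGen Reduces D E

/-- Two decompositions are equivalent if each is below the other. -/
def Equivalent {F σ : Type*} [Field F] [Fintype σ] {f : MvPolynomial σ F} {d r : ℕ}
    (D E : SliceDecomp f d r) : Prop :=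
  Below E D ∧ Below D E

end SliceDecomp

/-- The determinant polynomial of `n × n` matrices, in the variables `x (i, j)`. -/
noncomputable def detPoly (F : Type*) [Field F] (n : ℕ) : MvPolynomial (Fin n × Fin n) F :=
  (Matrix.mvPolynomialX (Fin n) (Fin n) F).det

/-- The Laplace expansion of the determinant of `(m + 1) × (m + 1)` matrices along the first row,
`det = ∑ j, x (0, j) * ((-1) ^ j * M j)`, where `M j` is the minor of the generic matrix
with row `0` and column `j` removed. -/
noncomputable def laplaceDecomp (F : Type*) [Field F] (m : ℕ) :
    SliceDecomp (detPoly F (m + 1)) (m + 1) (m + 1) where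
  α j := X (0, j)
  g j := (-1) ^ (j : ℕ) *
    ((Matrix.mvPolynomialX (Fin (m + 1)) (Fin (m + 1)) F).submatrix Fin.succ j.succAbove).det
  α_linear j := isHomogeneous_X F (0, j)
  g_form j := by
    rw [Matrix.det_apply', Finset.mul_sum]
    refine IsHomogeneous.sum _ _ _ fun s _ => ?_
    have h : (∏ i, ((Matrix.mvPolynomialX (Fin (m + 1)) (Fin (m + 1)) F).submatrix Fin.succ
        j.succAbove) (s i) i).IsHomogeneous (∑ _i : Fin m, 1) :=
      IsHomogeneous.prod _ _ _ fun i _ => isHomogeneous_X F _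
    simp only [Finset.sum_const, Finset.card_univ, Fintype.card_fin, smul_eq_mul, mul_one] at h
    rcases neg_one_pow_eq_or (MvPolynomial (Fin (m + 1) × Fin (m + 1)) F) (j : ℕ) with h1 | h1 <;>
      rcases Int.units_eq_one_or (Equiv.Perm.sign s) with h2 | h2 <;>
      first | simpa [h1, h2] using h | simpa [h1, h2] using h.neg
  sum_eq := by
    rw [detPoly, Matrix.det_succ_row_zero]
    exact Finset.sum_congr rfl fun j _ => by simp [Matrix.mvPolynomialX]; ring

/-! Let `det = ∑ α i * g i` have `r ≤ n` summands. On the common zero space of the `α i`, of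
codimension at most `r`, every matrix is singular. By Dieudonné's theorem
(`singularSpacesHaveKernel`) its matrices share a nonzero left or right kernel vector. The matrices
killed by a fixed nonzero vector form a space of codimension exactly `n`, so `r ≥ n`; the Laplace
expansion attains `n`.

Dieudonné's theorem is proved here over infinite fields. It is therefore applied over the algebraic
closure, where the zero space is still singular because the decomposition is an identity of
polynomials. The kernel vector then descends to `F`, since the `α i` have coefficients in `F`.

If `r = n`, transposition (a symmetry of the determinant) makes the kernel vector a left one, `w`.
The `n` independent entries of `w ᵥ* M` vanish on the zero space, so they lie in the span of the `α
i` and replace them by an invertible linear reduction. Left multiplication by a matrix of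
determinant 1 moves `w` to the first basis vector, and the linear forms become `x (0, j)`. Two
decompositions with these same linear forms differ by a syzygy of distinct variables, which is a
Koszul syzygy, that is, a syzygy reduction. All steps are reversible, hence the equivalence. -/

/-! ### Matrices with prescribed rows; common kernels of matrix spaces. -/

theorem LinearIndependent.exists_linearEquiv_apply_eq {K V ι : Type*} [Field K] [AddCommGroup V]
    [Module K V] [Finite ι] {u v : ι → V} (hu : LinearIndependent K u)
    (hv : LinearIndependent K v) : ∃ g : V ≃ₗ[K] V, ∀ i, g (u i) = v i := by
  have : FiniteDimensional K (Submodule.span K (Set.range u)) :=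
    FiniteDimensional.span_of_finite K (Set.finite_range _)
  obtain ⟨g, hg⟩ := Submodule.exists_linearEquiv_restrict_eq
    (hu.linearCombinationEquiv.symm ≪≫ₗ hv.linearCombinationEquiv)
  refine ⟨g, fun i => ?_⟩
  have h1 : (hu.linearCombinationEquiv (Finsupp.single i 1) : V) = u i := by simp
  have h2 : (hv.linearCombinationEquiv (Finsupp.single i 1) : V) = v i := by simp
  rw [← h1, ← hg, ← h2]
  simp

namespace Matrix

variable {K : Type*} [Field K]

theorem exists_isUnit_det_row_eq {ι κ : Type*} [Finite κ] [Fintype ι] [DecidableEq ι]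
    {f : κ → ι} (hf : Function.Injective f) {u : κ → ι → K} (hu : LinearIndependent K u) :
    ∃ Q : Matrix ι ι K, IsUnit Q.det ∧ ∀ k, Q (f k) = u k := by
  have h0 : LinearIndependent K (fun k => (Pi.single (f k) 1 : ι → K)) :=
    (Pi.linearIndependent_single_one ι K).comp f hf
  obtain ⟨g, hg⟩ := h0.exists_linearEquiv_apply_eq hu
  refine ⟨(LinearMap.toMatrix' g.toLinearMap)ᵀ, ?_, fun k => ?_⟩
  · rw [det_transpose, LinearMap.det_toMatrix']
    exact g.isUnit_det'
  · rw [← hg k]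
    ext j
    simp [LinearMap.toMatrix'_apply]

theorem exists_isUnit_det_row_zero_eq {n : ℕ} {u : Fin (n + 1) → K} (hu : u ≠ 0) :
    ∃ Q : Matrix (Fin (n + 1)) (Fin (n + 1)) K, IsUnit Q.det ∧ Q 0 = u := by
  obtain ⟨Q, hQ, h⟩ := exists_isUnit_det_row_eq (K := K) (ι := Fin (n + 1)) (κ := Unit)
    (f := fun _ => 0) (fun _ _ _ => rfl) (u := fun _ => u)
    (LinearIndependent.of_subsingleton () hu)
  exact ⟨Q, hQ, h ()⟩

/-- Rescaling the second row corrects the determinant without touching the first; this is where size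
at least 2 matters. Determinant 1 makes left multiplication a symmetry of the determinant. -/
theorem exists_det_eq_one_row_zero_eq {n : ℕ} {u : Fin (n + 2) → K} (hu : u ≠ 0) :
    ∃ Q : Matrix (Fin (n + 2)) (Fin (n + 2)) K, Q.det = 1 ∧ Q 0 = u := by
  obtain ⟨Q, hQ, h⟩ := exists_isUnit_det_row_zero_eq hu
  refine ⟨Q.updateRow 1 (Q.det⁻¹ • Q 1), ?_, ?_⟩
  · rw [det_updateRow_smul, updateRow_eq_self, inv_mul_cancel₀ hQ.ne_zero]
  · rw [updateRow_ne (by simp), h]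

/-- All matrices of `V` have a common nonzero left kernel vector. -/
def HasLeftKernel {ι : Type*} [Fintype ι] (V : Submodule K (Matrix ι ι K)) : Prop :=
  ∃ w : ι → K, w ≠ 0 ∧ ∀ M ∈ V, w ᵥ* M = 0

/-- All matrices of `V` have a common nonzero right kernel vector. -/
def HasRightKernel {ι : Type*} [Fintype ι] (V : Submodule K (Matrix ι ι K)) : Prop :=
  ∃ v : ι → K, v ≠ 0 ∧ ∀ M ∈ V, M *ᵥ v = 0

section

variable {ι : Type*} {V : Submodule K (Matrix ι ι K)}

/-- The space of transposes of the matrices of `V`. -/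
def transposeSpace (V : Submodule K (Matrix ι ι K)) : Submodule K (Matrix ι ι K) :=
  V.map (transposeLinearEquiv ι ι K K).toLinearMap

theorem mem_transposeSpace {M : Matrix ι ι K} : M ∈ transposeSpace V ↔ Mᵀ ∈ V := by
  constructor
  · rintro ⟨N, hN, rfl⟩
    simpa using hN
  · intro h
    exact ⟨Mᵀ, h, by simp⟩

theorem finrank_transposeSpace :
    Module.finrank K (transposeSpace V) = Module.finrank K V :=
  LinearEquiv.finrank_map_eq _ V

variable [Fintype ι]

theorem hasLeftKernel_transposeSpace : HasLeftKernel (transposeSpace V) ↔ HasRightKernel V := by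
  constructor
  · rintro ⟨w, hw, h⟩
    refine ⟨w, hw, fun M hM => ?_⟩
    simpa [vecMul_transpose] using h Mᵀ (mem_transposeSpace.2 (by simpa using hM))
  · rintro ⟨w, hw, h⟩
    refine ⟨w, hw, fun M hM => ?_⟩
    simpa [mulVec_transpose] using h Mᵀ (mem_transposeSpace.1 hM)

theorem hasRightKernel_transposeSpace : HasRightKernel (transposeSpace V) ↔ HasLeftKernel V := by
  constructor
  · rintro ⟨w, hw, h⟩
    refine ⟨w, hw, fun M hM => ?_⟩
    simpa [mulVec_transpose] using h Mᵀ (mem_transposeSpace.2 (by simpa using hM))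
  · rintro ⟨w, hw, h⟩
    refine ⟨w, hw, fun M hM => ?_⟩
    simpa [vecMul_transpose] using h Mᵀ (mem_transposeSpace.1 hM)

/-- For `w ≠ 0` the map `M ↦ w ᵥ* M` is onto, so its kernel, which contains `V`, has codimension
`Fintype.card ι`. -/
theorem HasLeftKernel.finrank_add_card_le (h : HasLeftKernel V) :
    Module.finrank K V + Fintype.card ι ≤ Fintype.card ι * Fintype.card ι := by
  classical
  obtain ⟨w, hw, h⟩ := h
  obtain ⟨i, hi⟩ := Function.ne_iff.1 hw
  let φ : Matrix ι ι K →ₗ[K] (ι → K) :=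
    { toFun := fun M => w ᵥ* M
      map_add' := fun M N => vecMul_add _ _ _
      map_smul' := fun c M => vecMul_smul _ _ _ }
  have hφ : Function.Surjective φ := fun y =>
    ⟨vecMulVec (Pi.single i (w i)⁻¹) y, by
      change w ᵥ* _ = y
      rw [vecMul_vecMulVec]
      simp [mul_inv_cancel₀ hi]⟩
  have hle : V ≤ LinearMap.ker φ := fun M hM => h M hM
  have h1 := Submodule.finrank_mono hle
  have h2 := φ.finrank_range_add_finrank_ker
  rw [LinearMap.range_eq_top.2 hφ, finrank_top, Module.finrank_matrix] at h2
  simp at h2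
  omega

theorem HasRightKernel.finrank_add_card_le (h : HasRightKernel V) :
    Module.finrank K V + Fintype.card ι ≤ Fintype.card ι * Fintype.card ι := by
  rw [← finrank_transposeSpace]
  exact (hasLeftKernel_transposeSpace.2 h).finrank_add_card_le

variable [DecidableEq ι]

/-- The space of the matrices `P * M * Q` for `M` in `V`. -/
def mulSpace (P Q : Matrix ι ι K) (V : Submodule K (Matrix ι ι K)) :
    Submodule K (Matrix ι ι K) :=
  V.map (LinearMap.mulLeft K P ∘ₗ LinearMap.mulRight K Q)

theorem mul_mul_mem_mulSpace {P Q M : Matrix ι ι K} (hM : M ∈ V) : P * M * Q ∈ mulSpace P Q V :=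
  ⟨M, hM, by simp [mul_assoc]⟩

theorem forall_mem_mulSpace {P Q : Matrix ι ι K} {p : Matrix ι ι K → Prop} :
    (∀ M ∈ mulSpace P Q V, p M) ↔ ∀ M ∈ V, p (P * M * Q) := by
  simp [mulSpace, mul_assoc]

theorem mul_mul_mem_mulSpace_iff {P Q M : Matrix ι ι K} (hP : IsUnit P.det) (hQ : IsUnit Q.det) :
    P * M * Q ∈ mulSpace P Q V ↔ M ∈ V := by
  refine ⟨?_, mul_mul_mem_mulSpace⟩
  rintro ⟨N, hN, h⟩
  have hP' := (isUnit_iff_isUnit_det P).2 hP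
  have hQ' := (isUnit_iff_isUnit_det Q).2 hQ
  have h' : P * (N * Q) = P * (M * Q) := by simpa [mul_assoc] using h
  rwa [← hQ'.mul_right_cancel (hP'.mul_left_cancel h')]

theorem finrank_mulSpace {P Q : Matrix ι ι K} (hP : IsUnit P.det) (hQ : IsUnit Q.det) :
    Module.finrank K (mulSpace P Q V) = Module.finrank K V := by
  have hP' := (isUnit_iff_isUnit_det P).2 hP
  have hQ' := (isUnit_iff_isUnit_det Q).2 hQ
  refine (LinearEquiv.finrank_eq (Submodule.equivMapOfInjective _ ?_ V)).symm
  intro M N h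
  have h' : P * (M * Q) = P * (N * Q) := by simpa using h
  exact hQ'.mul_right_cancel (hP'.mul_left_cancel h')

theorem HasLeftKernel.of_mulSpace {P Q : Matrix ι ι K} (hP : IsUnit P.det) (hQ : IsUnit Q.det)
    (h : HasLeftKernel (mulSpace P Q V)) : HasLeftKernel V := by
  obtain ⟨w, hw, h⟩ := h
  refine ⟨w ᵥ* P, fun h0 => hw ?_, fun M hM => ?_⟩
  · exact vecMul_injective_of_isUnit ((isUnit_iff_isUnit_det P).2 hP) (by simpa using h0)
  · have h1 := h _ (mul_mul_mem_mulSpace (P := P) (Q := Q) hM)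
    refine vecMul_injective_of_isUnit ((isUnit_iff_isUnit_det Q).2 hQ) ?_
    simpa [vecMul_vecMul, mul_assoc] using h1

theorem transposeSpace_mulSpace {P Q : Matrix ι ι K} :
    transposeSpace (mulSpace P Q V) = mulSpace Qᵀ Pᵀ (transposeSpace V) := by
  ext M
  rw [mem_transposeSpace]
  constructor
  · rintro ⟨N, hN, h⟩
    refine ⟨Nᵀ, mem_transposeSpace.2 (by simpa using hN), ?_⟩
    rw [← transpose_transpose M, ← h]
    simp [transpose_mul, mul_assoc]
  · rintro ⟨N, hN, rfl⟩
    refine ⟨Nᵀ, mem_transposeSpace.1 hN, ?_⟩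
    simp [transpose_mul, mul_assoc]

theorem HasRightKernel.of_mulSpace {P Q : Matrix ι ι K} (hP : IsUnit P.det) (hQ : IsUnit Q.det)
    (h : HasRightKernel (mulSpace P Q V)) : HasRightKernel V := by
  rw [← hasLeftKernel_transposeSpace, transposeSpace_mulSpace] at h
  exact hasLeftKernel_transposeSpace.1
    (h.of_mulSpace (by rwa [det_transpose]) (by rwa [det_transpose]))

end

end Matrix

/-! ### Dieudonné's theorem on spaces of singular matrices. -/

namespace Matrix

variable {K : Type*} [Field K] {n : ℕ}

/-- By `h0` and the dimension bound, deleting row 0 identifies `V` with all choices of the other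
rows. Row 0 is then a sum of linear functions `φ i` of the single rows. Singularity forces each `φ
i` to be a scalar, so row 0 is a fixed combination of the others. -/
theorem hasLeftKernel_of_forall_tail_eq_zero {t : K} (ht0 : t ≠ 0) (ht1 : t ≠ 1)
    {V : Submodule K (Matrix (Fin (n + 1)) (Fin (n + 1)) K)}
    (hV : (n + 1) * (n + 1) ≤ Module.finrank K V + (n + 1)) (hs : ∀ M ∈ V, M.det = 0)
    (h0 : ∀ M ∈ V, (∀ i : Fin n, M i.succ = 0) → M = 0) : HasLeftKernel V := by
  let ρ : V →ₗ[K] (Fin n → Fin (n + 1) → K) :=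
    { toFun := fun M i => M.1 i.succ
      map_add' := fun M N => rfl
      map_smul' := fun c M => rfl }
  have hinj : Function.Injective ρ := by
    rw [← LinearMap.ker_eq_bot, LinearMap.ker_eq_bot']
    intro M hM
    exact Subtype.ext (h0 M.1 M.2 fun i => congrFun hM i)
  have hcard : Module.finrank K (Fin n → Fin (n + 1) → K) = n * (n + 1) := by
    simp [Module.finrank_pi_fintype]
  have hle := LinearMap.finrank_le_finrank_of_injective hinj
  have hfr : Module.finrank K V = Module.finrank K (Fin n → Fin (n + 1) → K) := by
    rw [hcard] at hle ⊢
    nlinarith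
  let e := LinearEquiv.ofInjectiveOfFinrankEq ρ hinj hfr
  have he (N : Fin n → Fin (n + 1) → K) (i : Fin n) : (e.symm N).1 i.succ = N i := by
    have : ρ (e.symm N) = N := e.apply_symm_apply N
    exact congrFun this i
  let φ (i : Fin n) : (Fin (n + 1) → K) →ₗ[K] (Fin (n + 1) → K) :=
    { toFun := fun y => (e.symm (Pi.single i y)).1 0
      map_add' := fun y z => by rw [Pi.single_add, map_add]; rfl
      map_smul' := fun c y => by rw [Pi.single_smul, map_smul]; rfl }
  have key (N : Fin n → Fin (n + 1) → K) (i : Fin n) :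
      ((e.symm N).1.updateRow 0 (φ i (N i))).det = 0 := by
    set A := (e.symm N).1 with hA
    set B := (e.symm (Pi.single i (N i))).1 with hB
    -- Adding `(t - 1) • B` multiplies row `i` of the tail by `t` and adds `(t - 1) • B 0` to row 0.
    -- Expanding the determinant, with `A` singular and `t ≠ 0, 1`, isolates the contribution of `φ
    -- i` alone.
    have hAB : A + (t - 1) • B =
        (A.updateRow 0 (A 0 + (t - 1) • B 0)).updateRow i.succ (t • A i.succ) := by
      ext a b
      refine Fin.cases ?_ (fun a => ?_) a
      · simp [updateRow_apply, (Fin.succ_ne_zero i).symm]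
      · have h1 : B a.succ = Pi.single (M := fun _ => Fin (n + 1) → K) i (N i) a := he _ a
        have h2 : A a.succ = N a := he _ a
        by_cases hai : a = i
        · subst hai
          simp only [add_apply, smul_apply, h1, h2, updateRow_self, Pi.single_eq_same,
            Pi.smul_apply, smul_eq_mul]
          ring
        · simp [updateRow_apply, hai, h1, h2]
    have h1 : (A + (t - 1) • B).det = 0 :=
      hs _ (V.add_mem (e.symm N).2 (V.smul_mem _ (e.symm (Pi.single i (N i))).2))
    have h2 : A i.succ = (A.updateRow 0 (A 0 + (t - 1) • B 0)) i.succ := by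
      rw [updateRow_ne (Fin.succ_ne_zero i)]
    rw [hAB, h2, det_updateRow_smul, updateRow_eq_self, det_updateRow_add, updateRow_eq_self,
      det_updateRow_smul, hs A (e.symm N).2, zero_add] at h1
    change (A.updateRow 0 (B 0)).det = 0
    simpa [ht0, sub_eq_zero, ht1] using h1
  have hφ (i : Fin n) : ∃ a : K, φ i = a • 1 := by
    refine LinearMap.exists_eq_smul_id_of_forall_notLinearIndependent fun y hy => ?_
    -- If `y` and `φ i y` were independent, the remaining rows could be chosen to complete them to a
    -- basis, contradicting `key`.
    obtain ⟨Q, hQ, hrow⟩ := exists_isUnit_det_row_eq (K := K) (f := ![i.succ, 0])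
      (by
        intro a b
        fin_cases a <;> fin_cases b <;> simp [Fin.succ_ne_zero, (Fin.succ_ne_zero i).symm]) hy
    have h1 : Q i.succ = y := hrow 0
    have h2 : Q 0 = φ i y := hrow 1
    have h3 := key (fun k => Q k.succ) i
    rw [h1, ← h2] at h3
    refine hQ.ne_zero ?_
    rw [← h3]
    congr 1
    ext a b
    refine Fin.cases ?_ (fun a => ?_) a
    · simp
    · rw [updateRow_ne (Fin.succ_ne_zero a), he]
  choose a ha using hφ
  refine ⟨Fin.cons 1 (-a), fun h => one_ne_zero (congrFun h 0), fun M hM => ?_⟩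
  have hM0 : M 0 = ∑ i, a i • M i.succ := by
    have h1 : (⟨M, hM⟩ : V) = ∑ i, e.symm (Pi.single i (M i.succ)) := by
      rw [← map_sum, Finset.univ_sum_single (fun i : Fin n => M i.succ)]
      exact (e.symm_apply_apply ⟨M, hM⟩).symm
    have h2 := congrArg (fun N : V => N.1 0) h1
    simp only [Submodule.coe_sum] at h2
    have h3 : (∑ i, (e.symm (Pi.single i (M i.succ))).1) 0 =
        ∑ i, (e.symm (Pi.single i (M i.succ))).1 0 := Finset.sum_apply _ _ _
    rw [h2, h3]
    refine Finset.sum_congr rfl fun i _ => ?_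
    have h4 : φ i (M i.succ) = a i • M i.succ := by rw [ha i]; rfl
    exact h4
  ext j
  simp only [vecMul, dotProduct, Fin.sum_univ_succ, Fin.cons_zero, Fin.cons_succ, Pi.neg_apply]
  rw [hM0]
  simp [Finset.sum_apply]

/-- A change of basis takes `x` to the first basis vector; the matrices `vecMulVec x y` become those
supported in row 0. -/
theorem hasLeftKernel_of_forall_vecMulVec {t : K} (ht0 : t ≠ 0) (ht1 : t ≠ 1)
    {V : Submodule K (Matrix (Fin (n + 1)) (Fin (n + 1)) K)}
    (hV : (n + 1) * (n + 1) ≤ Module.finrank K V + (n + 1)) (hs : ∀ M ∈ V, M.det = 0)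
    {x : Fin (n + 1) → K} (hx : x ≠ 0) (h0 : ∀ y, vecMulVec x y ∈ V → y = 0) :
    HasLeftKernel V := by
  obtain ⟨Q, hQ, hQx⟩ := exists_isUnit_det_row_zero_eq hx
  have hU : IsUnit Qᵀ.det := by rwa [det_transpose]
  have hP : IsUnit (Qᵀ⁻¹).det := isUnit_nonsing_inv_det _ hU
  have h1 : IsUnit (1 : Matrix (Fin (n + 1)) (Fin (n + 1)) K).det := by simp
  refine HasLeftKernel.of_mulSpace hP h1 (hasLeftKernel_of_forall_tail_eq_zero ht0 ht1 ?_ ?_ ?_)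
  · rwa [finrank_mulSpace hP h1]
  · rw [forall_mem_mulSpace]
    intro M hM
    simp [det_mul, hs M hM]
  · rw [forall_mem_mulSpace]
    intro M hM hMt
    rw [mul_one] at hMt ⊢
    have h2 : Qᵀ⁻¹ * M = vecMulVec (Pi.single 0 1) ((Qᵀ⁻¹ * M) 0) := by
      ext a b
      refine Fin.cases ?_ (fun a => ?_) a
      · simp [vecMulVec_apply]
      · rw [hMt a]; simp [vecMulVec_apply]
    have h3 : M = vecMulVec x ((Qᵀ⁻¹ * M) 0) := by
      have h4 : M = Qᵀ * (Qᵀ⁻¹ * M) := by rw [mul_nonsing_inv_cancel_left _ _ hU]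
      rw [h2, mul_vecMulVec] at h4
      convert h4 using 2
      ext i
      simp [← hQx]
    have h4 := h0 _ (h3 ▸ hM)
    rw [h2, h4]
    ext; simp [vecMulVec_apply]

/-- Spaces of singular `n × n` matrices of codimension at most `n` have a common left or right
kernel vector. -/
def SingularSpacesHaveKernel (K : Type*) [Field K] (n : ℕ) : Prop :=
  ∀ V : Submodule K (Matrix (Fin n) (Fin n) K), n * n ≤ Module.finrank K V + n →
    (∀ M ∈ V, M.det = 0) → HasLeftKernel V ∨ HasRightKernel V

/-- Deleting the first row and column. -/
def lowerBlock (K : Type*) [Field K] (n : ℕ) :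
    Matrix (Fin (n + 1)) (Fin (n + 1)) K →ₗ[K] Matrix (Fin n) (Fin n) K where
  toFun M := M.submatrix Fin.succ Fin.succ
  map_add' _ _ := rfl
  map_smul' _ _ := rfl

@[simp]
theorem lowerBlock_apply (M : Matrix (Fin (n + 1)) (Fin (n + 1)) K) (i j : Fin n) :
    lowerBlock K n M i j = M i.succ j.succ := rfl

/-- On the line `M + t • M₀` both factors are polynomials in `t`. Their product vanishes at
infinitely many points, hence identically, and the factor from `c` has leading coefficient `c M₀ ≠
0`. -/
theorem det_eq_zero_of_forall_mul_eq_zero [Infinite K] {ι κ : Type*} [Fintype ι] [DecidableEq ι]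
    {V : Submodule K (Matrix κ κ K)} (c : Matrix κ κ K →ₗ[K] K)
    (p : Matrix κ κ K →ₗ[K] Matrix ι ι K) (h : ∀ M ∈ V, c M * (p M).det = 0)
    {M₀ : Matrix κ κ K} (hM₀ : M₀ ∈ V) (hc : c M₀ ≠ 0) : ∀ M ∈ V, (p M).det = 0 := by
  intro M hM
  let f : Polynomial K := Polynomial.C (c M) + Polynomial.X * Polynomial.C (c M₀)
  let g : Polynomial K :=
    ((p M).map Polynomial.C + (Polynomial.X : Polynomial K) • (p M₀).map Polynomial.C).det
  have hg (t : K) : g.eval t = (p (M + t • M₀)).det := by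
    simp only [g, ← Polynomial.coe_evalRingHom, RingHom.map_det]
    congr 1
    ext i j
    simpa using mul_comm _ _
  have hfg : f * g = 0 := by
    refine Polynomial.funext fun t => ?_
    rw [Polynomial.eval_mul, hg, Polynomial.eval_zero,
      ← h _ (V.add_mem hM (V.smul_mem t hM₀))]
    simpa [f] using Or.inl (mul_comm _ _)
  rcases mul_eq_zero.1 hfg with hf | hg0
  · refine absurd ?_ hc
    have := congrArg (fun q => Polynomial.coeff q 1) hf
    simpa [f] using this
  · have := hg 0
    rw [hg0] at this
    simpa using this.symm

/-- Combining the rows with coefficients `(0, w)` leaves only an entry `c M` in column 0. Either `c`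
vanishes on `V` and `(0, w)` is a left kernel vector, or the complementary minors `p M` all vanish,
which by induction and a dimension count is possible only for `n = 1`. -/
theorem hasKernel_of_lowerBlock_left [Infinite K] (ih : SingularSpacesHaveKernel K n)
    {V : Submodule K (Matrix (Fin (n + 1)) (Fin (n + 1)) K)}
    (hV : (n + 1) * (n + 1) ≤ Module.finrank K V + (n + 1)) (hs : ∀ M ∈ V, M.det = 0)
    (hL : HasLeftKernel (V.map (lowerBlock K n))) : HasLeftKernel V ∨ HasRightKernel V := by
  obtain ⟨w, hw, hwV⟩ := hL
  replace hwV : ∀ M ∈ V, ∀ j : Fin n, ∑ i, w i * M i.succ j.succ = 0 := by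
    intro M hM j
    exact congrFun (hwV _ ⟨M, hM, rfl⟩) j
  obtain ⟨i₀, hi₀⟩ := Function.ne_iff.1 hw
  let c : Matrix (Fin (n + 1)) (Fin (n + 1)) K →ₗ[K] K :=
    { toFun := fun M => ∑ i, w i * M i.succ 0
      map_add' := fun M N => by simp [mul_add, Finset.sum_add_distrib]
      map_smul' := fun r M => by
        simp only [smul_apply, smul_eq_mul, Finset.mul_sum, RingHom.id_apply]
        exact Finset.sum_congr rfl fun i _ => by ring }
  let p : Matrix (Fin (n + 1)) (Fin (n + 1)) K →ₗ[K] Matrix (Fin n) (Fin n) K :=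
    { toFun := fun M => M.submatrix i₀.succ.succAbove Fin.succ
      map_add' := fun M N => rfl
      map_smul' := fun r M => rfl }
  have hrow : ∀ M ∈ V, (∑ k, (Fin.cons 0 w : Fin (n + 1) → K) k • M k) = Pi.single 0 (c M) := by
    intro M hM
    ext j
    rw [Fin.sum_univ_succ]
    refine Fin.cases ?_ (fun j => ?_) j
    · simp [c, Finset.sum_apply]
    · simpa [Finset.sum_apply] using hwV M hM j
  have hcp : ∀ M ∈ V, c M * (p M).det = 0 := by
    intro M hM
    -- Replacing row `i₀.succ` by the combination multiplies the determinant by `w i₀`; expansion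
    -- along that row gives `± c M * (p M).det`.
    have h1 := det_updateRow_sum M i₀.succ (Fin.cons 0 w)
    rw [hs M hM, hrow M hM, smul_zero, det_succ_row _ i₀.succ, Fin.sum_univ_succ] at h1
    change c M * (M.submatrix i₀.succ.succAbove Fin.succ).det = 0
    simpa [submatrix_updateRow_succAbove] using h1
  by_cases hc : ∀ M ∈ V, c M = 0
  · left
    refine ⟨Fin.cons 0 w, fun h => hw (funext fun i => ?_), fun M hM => ?_⟩
    · simpa using congrFun h i.succ
    · ext j
      have := congrFun (hrow M hM) j
      rw [hc M hM] at this
      simpa [vecMul, dotProduct, Finset.sum_apply] using this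
  push Not at hc
  obtain ⟨M₀, hM₀, hcM₀⟩ := hc
  have hdet := det_eq_zero_of_forall_mul_eq_zero c p hcp hM₀ hcM₀
  -- A matrix of `V` killed by `p` is determined by its column 0, because `w i₀ ≠ 0` recovers the
  -- rest of row `i₀.succ`.
  let q : LinearMap.ker (p.domRestrict V) →ₗ[K] (Fin (n + 1) → K) :=
    { toFun := fun M i => M.1.1 i 0
      map_add' := fun M N => rfl
      map_smul' := fun r M => rfl }
  have hz : ∀ M ∈ V, p M = 0 → (∀ i, M i 0 = 0) → M = 0 := by
    intro M hM hpM hqM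
    have hp (i : Fin n) (j : Fin n) : M (i₀.succ.succAbove i) j.succ = 0 :=
      congrFun (congrFun hpM i) j
    ext i j
    refine Fin.cases (hqM i) (fun j => ?_) j
    by_cases hi : i = i₀.succ
    · subst hi
      have h1 := hwV M hM j
      rw [Finset.sum_eq_single i₀] at h1
      · exact (mul_eq_zero.1 h1).resolve_left hi₀
      · intro i _ hi
        obtain ⟨k, hk⟩ := Fin.exists_succAbove_eq (show i.succ ≠ i₀.succ by simpa using hi)
        rw [← hk, hp, mul_zero]
      · simp
    · obtain ⟨k, rfl⟩ := Fin.exists_succAbove_eq hi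
      exact hp k j
  have hq : Function.Injective q := by
    intro M N h
    have hp : p (M.1.1 - N.1.1) = 0 := by
      rw [map_sub, sub_eq_zero]
      exact (show p M.1.1 = 0 from M.2).trans (show p N.1.1 = 0 from N.2).symm
    exact Subtype.ext (Subtype.ext (sub_eq_zero.1 (hz _ (V.sub_mem M.1.2 N.1.2) hp
      fun i => sub_eq_zero.2 (congrFun h i))))
  have h1 := LinearMap.finrank_le_finrank_of_injective hq
  have h2 := (p.domRestrict V).finrank_range_add_finrank_ker
  rw [LinearMap.range_domRestrict] at h2
  simp only [Module.finrank_fintype_fun_eq_card, Fintype.card_fin] at h1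
  have hn : 0 < n := i₀.pos
  have hpV := ih (V.map p) (by nlinarith) (by rintro _ ⟨M, hM, rfl⟩; exact hdet M hM)
  have h3 : Module.finrank K (V.map p) + n ≤ n * n := by
    rcases hpV with h | h <;> simpa using h.finrank_add_card_le
  -- The image of `V` under `p` has dimension at least `n * n - 1`, and at most `n * n - n` by its
  -- common kernel.
  obtain rfl : n = 1 := by nlinarith
  right
  refine ⟨Pi.single 1 1, by simp, fun M hM => ?_⟩
  have h4 : M 0 1 = 0 := by
    have := hdet M hM
    rw [det_unique] at this
    have hz : i₀.succ.succAbove 0 = 0 := by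
      rw [Subsingleton.elim i₀ 0]; rfl
    change M (i₀.succ.succAbove 0) 1 = 0 at this
    rwa [hz] at this
  have h5 : M 1 1 = 0 := by
    have := hwV M hM 0
    rw [Fin.sum_univ_one, Subsingleton.elim i₀ 0] at *
    exact (mul_eq_zero.1 this).resolve_left hi₀
  ext i
  fin_cases i <;> simp [h4, h5]

/-- Adding `single 0 0 1` to `M` changes the determinant by that of the lower block, so the lower
blocks are singular too and the induction hypothesis can be applied to them. -/
theorem hasKernel_of_single_mem [Infinite K] (ih : SingularSpacesHaveKernel K n)
    {V : Submodule K (Matrix (Fin (n + 1)) (Fin (n + 1)) K)}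
    (hV : (n + 1) * (n + 1) ≤ Module.finrank K V + (n + 1)) (hs : ∀ M ∈ V, M.det = 0)
    (h00 : single 0 0 1 ∈ V) (hcross : ¬ LinearMap.ker (lowerBlock K n) ≤ V) :
    HasLeftKernel V ∨ HasRightKernel V := by
  have hdet : ∀ M ∈ V, (lowerBlock K n M).det = 0 := by
    intro M hM
    have h1 := hs _ (V.add_mem hM h00)
    have h2 : M + single 0 0 1 = M.updateRow 0 (M 0 + Pi.single 0 1) := by
      ext i j
      refine Fin.cases ?_ (fun i => ?_) i
      · simp [Pi.single_apply, single_apply, eq_comm]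
      · simp [updateRow_apply, (Fin.succ_ne_zero i).symm]
    rw [h2, det_updateRow_add, updateRow_eq_self, hs M hM, zero_add, det_succ_row_zero,
      Fin.sum_univ_succ] at h1
    have h3 : (M.updateRow 0 (Pi.single 0 1)).submatrix Fin.succ Fin.succ
        = lowerBlock K n M := by
      ext i j
      simp
    simpa [h3] using h1
  have hsurj : Function.Surjective (lowerBlock K n) := fun N =>
    ⟨fun i j => Fin.cases 0 (fun i => Fin.cases 0 (fun j => N i j) j) i, by
      ext i j; rfl⟩
  have h1 := (lowerBlock K n).finrank_range_add_finrank_ker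
  rw [LinearMap.range_eq_top.2 hsurj, finrank_top] at h1
  have h2 := ((lowerBlock K n).domRestrict V).finrank_range_add_finrank_ker
  rw [LinearMap.range_domRestrict] at h2
  -- The kernel of `lowerBlock` has dimension `2 * n + 1`. As `V` does not contain it, at most `2 *
  -- n` dimensions are lost, and the image has codimension at most `n`.
  have h3 : Module.finrank K (LinearMap.ker ((lowerBlock K n).domRestrict V)) <
      Module.finrank K (LinearMap.ker (lowerBlock K n)) := by
    have h4 : LinearMap.ker (lowerBlock K n) ⊓ V < LinearMap.ker (lowerBlock K n) :=
      lt_of_le_of_ne inf_le_left fun h => hcross (inf_eq_left.1 h)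
    refine lt_of_le_of_lt ?_ (Submodule.finrank_lt_finrank_of_lt h4)
    let q : LinearMap.ker ((lowerBlock K n).domRestrict V) →ₗ[K]
        (LinearMap.ker (lowerBlock K n) ⊓ V : Submodule K _) :=
      { toFun := fun M => ⟨M.1.1, M.2, M.1.2⟩
        map_add' := fun M N => rfl
        map_smul' := fun r M => rfl }
    refine LinearMap.finrank_le_finrank_of_injective (f := q) fun M N h => ?_
    exact Subtype.ext (Subtype.ext (congrArg (fun R => R.1) h))
  simp only [Module.finrank_matrix, Fintype.card_fin, Module.finrank_self, mul_one] at h1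
  have h4 : n * n ≤ Module.finrank K (V.map (lowerBlock K n)) + n := by nlinarith
  rcases ih (V.map (lowerBlock K n)) h4 (by rintro _ ⟨M, hM, rfl⟩; exact hdet M hM) with h | h
  · exact hasKernel_of_lowerBlock_left ih hV hs h
  · have h5 : HasLeftKernel ((transposeSpace V).map (lowerBlock K n)) := by
      have h6 : (transposeSpace V).map (lowerBlock K n) =
          transposeSpace (V.map (lowerBlock K n)) := by
        simp only [transposeSpace, ← Submodule.map_comp]
        rfl
      rwa [h6, hasLeftKernel_transposeSpace]
    have h6 := hasKernel_of_lowerBlock_left ih (V := transposeSpace V)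
      (by rwa [finrank_transposeSpace])
      (fun M hM => by rw [← det_transpose]; exact hs _ (mem_transposeSpace.1 hM)) h5
    rw [hasLeftKernel_transposeSpace, hasRightKernel_transposeSpace] at h6
    exact h6.symm

/-- Changes of basis take `vecMulVec x y` to `single 0 0 1`, and `vecMulVec x z` to a matrix
supported in row 0, which witnesses that the kernel of `lowerBlock` is not contained in the space.
-/
theorem hasKernel_of_vecMulVec_mem [Infinite K] (ih : SingularSpacesHaveKernel K n)
    {V : Submodule K (Matrix (Fin (n + 1)) (Fin (n + 1)) K)}
    (hV : (n + 1) * (n + 1) ≤ Module.finrank K V + (n + 1)) (hs : ∀ M ∈ V, M.det = 0)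
    {x y : Fin (n + 1) → K} (hx : x ≠ 0) (hy : y ≠ 0) (hxy : vecMulVec x y ∈ V)
    {z : Fin (n + 1) → K} (hz : vecMulVec x z ∉ V) :
    HasLeftKernel V ∨ HasRightKernel V := by
  obtain ⟨P, hP, hPx⟩ := exists_isUnit_det_row_zero_eq hx
  obtain ⟨Q, hQ, hQy⟩ := exists_isUnit_det_row_zero_eq hy
  have hP1 : IsUnit Pᵀ.det := by rwa [det_transpose]
  have hP2 : IsUnit (Pᵀ⁻¹).det := isUnit_nonsing_inv_det _ hP1
  have hQ2 : IsUnit (Q⁻¹).det := isUnit_nonsing_inv_det _ hQ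
  have hx' : Pᵀ⁻¹ *ᵥ x = Pi.single 0 1 := by
    have : x = Pᵀ *ᵥ Pi.single 0 1 := by ext i; simp [← hPx]
    rw [this, mulVec_mulVec, nonsing_inv_mul _ hP1, one_mulVec]
  have hy' : y ᵥ* Q⁻¹ = Pi.single 0 1 := by
    have : y = Pi.single 0 1 ᵥ* Q := by ext i; simp [← hQy]
    rw [this, vecMul_vecMul, mul_nonsing_inv _ hQ, vecMul_one]
  have h := hasKernel_of_single_mem ih (V := mulSpace Pᵀ⁻¹ Q⁻¹ V)
    (by rwa [finrank_mulSpace hP2 hQ2])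
    (by
      rw [forall_mem_mulSpace]
      intro M hM
      simp [det_mul, hs M hM])
    (by
      have h1 := mul_mul_mem_mulSpace (P := Pᵀ⁻¹) (Q := Q⁻¹) hxy
      rw [mul_vecMulVec, vecMulVec_mul, hx', hy'] at h1
      convert h1 using 1
      ext i j
      simp only [single_apply, vecMulVec_apply, Pi.single_apply, eq_comm (a := (0 : Fin (n + 1))),
        ite_and]
      split_ifs <;> simp)
    (by
      intro hle
      refine hz ((mul_mul_mem_mulSpace_iff hP2 hQ2).1 (hle ?_))
      rw [mul_vecMulVec, vecMulVec_mul, hx']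
      rw [LinearMap.mem_ker]
      ext i j
      simp [vecMulVec_apply])
  exact h.imp (HasLeftKernel.of_mulSpace hP2 hQ2) (HasRightKernel.of_mulSpace hP2 hQ2)

/-- **Dieudonné's theorem** on linear spaces of singular matrices of codimension at most `n`. -/
theorem singularSpacesHaveKernel (K : Type*) [Field K] [Infinite K] (n : ℕ) :
    SingularSpacesHaveKernel K n := by
  induction n with
  | zero => exact fun V _ hs => absurd (hs 0 V.zero_mem) (by simp)
  | succ n ih =>
    intro V hV hs
    classical
    obtain ⟨t, ht⟩ := Infinite.exists_notMem_finset ({0, 1} : Finset K)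
    simp only [Finset.mem_insert, Finset.mem_singleton, not_or] at ht
    by_cases h : ∃ x : Fin (n + 1) → K, x ≠ 0 ∧ ∀ y, vecMulVec x y ∈ V → y = 0
    · obtain ⟨x, hx, h0⟩ := h
      exact Or.inl (hasLeftKernel_of_forall_vecMulVec ht.1 ht.2 hV hs hx h0)
    by_cases h' : ∃ x y z : Fin (n + 1) → K, x ≠ 0 ∧ y ≠ 0 ∧ vecMulVec x y ∈ V ∧
        vecMulVec x z ∉ V
    · obtain ⟨x, y, z, hx, hy, hxy, hz⟩ := h'
      exact hasKernel_of_vecMulVec_mem ih hV hs hx hy hxy hz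
    -- In the remaining case `V` contains all matrices of rank one, hence the identity, which is not
    -- singular.
    push Not at h h'
    have hall (x z : Fin (n + 1) → K) : vecMulVec x z ∈ V := by
      by_cases hx : x = 0
      · rw [hx, zero_vecMulVec]; exact V.zero_mem
      · obtain ⟨y, hy, hy0⟩ := h x hx
        exact h' x y z hx hy0 hy
    have h1 : (1 : Matrix (Fin (n + 1)) (Fin (n + 1)) K) ∈ V := by
      have : (1 : Matrix (Fin (n + 1)) (Fin (n + 1)) K) =
          ∑ i, vecMulVec (Pi.single i 1) (Pi.single i 1) := by
        ext a b
        simp only [sum_apply, vecMulVec_apply, one_apply, Pi.single_apply]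
        simp
      rw [this]
      exact V.sum_mem fun i _ => hall _ _
    exact absurd (hs 1 h1) (by simp)

end Matrix

/-! ### Koszul syzygies of variables. -/

namespace MvPolynomial

variable {F σ ι : Type*} [Field F] [DecidableEq ι]

theorem homogeneousComponent_mul_X {F σ : Type*} [CommSemiring F] (e : ℕ)
    (p : MvPolynomial σ F) (i : σ) :
    homogeneousComponent (e + 1) (p * X i) = homogeneousComponent e p * X i := by
  classical
  ext m
  rw [coeff_homogeneousComponent, coeff_mul_X', coeff_mul_X', coeff_homogeneousComponent]
  by_cases hi : i ∈ m.support
  · obtain ⟨m', rfl⟩ : ∃ m', m = m' + Finsupp.single i 1 :=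
      ⟨m - Finsupp.single i 1, (tsub_add_cancel_of_le (by
        rw [Finsupp.single_le_iff]
        exact Nat.one_le_iff_ne_zero.2 (Finsupp.mem_support_iff.1 hi))).symm⟩
    simp [hi]
  · simp [hi]

/-- Exactness of the Koszul complex of distinct variables, for forms: a syzygy of the variables
supported on `T` is given by an alternating matrix. -/
theorem exists_alternating_of_sum_X_mul_eq_zero {v : ι → σ} (hv : Function.Injective v) (e : ℕ)
    (T : Finset ι) (s : ι → MvPolynomial σ F) (hs : ∀ i, (s i).IsHomogeneous (e + 1))
    (h : ∑ i ∈ T, X (v i) * s i = 0) :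
    ∃ q : Matrix ι ι (MvPolynomial σ F), (∀ i j, (q i j).IsHomogeneous e) ∧ (∀ i, q i i = 0) ∧
      (∀ i j, q i j = -q j i) ∧ ∀ i ∈ T, s i = ∑ j ∈ T, q i j * X (v j) := by
  induction T using Finset.induction_on generalizing s with
  | empty => exact ⟨0, fun _ _ => isHomogeneous_zero _ _ _, fun _ => rfl, by simp, by simp⟩
  | insert a T ha ih =>
    rw [Finset.sum_insert ha] at h
    -- `X (v a)` is a nonzerodivisor modulo the other variables: a monomial of `X (v a) * s a`
    -- divisible by some `X (v i)` with `i ∈ T` owes this to `s a`.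
    have hmem : s a ∈ Ideal.span (X '' (v '' T) : Set (MvPolynomial σ F)) := by
      rw [mem_ideal_span_X_image]
      intro m hm
      have h1 : X (v a) * s a ∈ Ideal.span (X '' (v '' T) : Set (MvPolynomial σ F)) := by
        rw [eq_neg_of_add_eq_zero_left h]
        refine neg_mem (sum_mem fun i hi => Ideal.mul_mem_right _ _ (Ideal.subset_span ?_))
        exact ⟨v i, ⟨i, hi, rfl⟩, rfl⟩
      rw [mem_ideal_span_X_image] at h1
      obtain ⟨_, ⟨i, hi, rfl⟩, hne⟩ := h1 (Finsupp.single (v a) 1 + m) (by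
        rw [mem_support_iff, coeff_X_mul]
        exact mem_support_iff.1 hm)
      refine ⟨v i, ⟨i, hi, rfl⟩, ?_⟩
      have hia : v a ≠ v i := fun h => ha (hv h ▸ hi)
      simpa [Finsupp.single_apply, hia] using hne
    have hp : ∃ p : ι → MvPolynomial σ F, (∀ i, (p i).IsHomogeneous e) ∧
        s a = ∑ i ∈ T, p i * X (v i) := by
      rw [← Set.image_comp, Ideal.span, Submodule.mem_span_image_finset_iff_exists_fun'] at hmem
      obtain ⟨p, hp⟩ := hmem
      refine ⟨fun i => homogeneousComponent e (p i),
        fun i => homogeneousComponent_isHomogeneous _ _, ?_⟩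
      rw [← homogeneousComponent_eq_self (hs a), ← hp, map_sum]
      exact Finset.sum_congr rfl fun i _ => homogeneousComponent_mul_X e (p i) (v i)
    obtain ⟨p, hp, hpa⟩ := hp
    -- Substituting `s a = ∑ p i * X (v i)` turns the relation into a syzygy supported on `T`; the
    -- `p i` then fill row and column `a` of the matrix.
    obtain ⟨q, hq, hqd, hqs, hqT⟩ := ih (fun i => s i + X (v a) * p i)
      (fun i => (hs i).add (by rw [add_comm]; exact (isHomogeneous_X F _).mul (hp i))) (by
        rw [← h, hpa, Finset.mul_sum, ← Finset.sum_add_distrib]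
        exact Finset.sum_congr rfl fun i _ => by ring)
    refine ⟨fun i j => if i = a then (if j = a then 0 else p j) else
      if j = a then -p i else q i j, ?_, ?_, ?_, ?_⟩
    · intro i j
      dsimp only
      split_ifs
      exacts [isHomogeneous_zero _ _ _, hp j, (hp i).neg, hq i j]
    · intro i
      by_cases hi : i = a <;> simp [hi, hqd]
    · intro i j
      by_cases hi : i = a <;> by_cases hj : j = a <;> simp [hi, hj, ← hqs]
    · intro i hi
      rw [Finset.sum_insert ha]
      rcases Finset.mem_insert.1 hi with rfl | hi
      · rw [hpa]
        simp only [if_true, zero_mul, zero_add]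
        refine Finset.sum_congr rfl fun j hj => ?_
        rw [if_neg (ne_of_mem_of_not_mem hj ha)]
      · have hia : i ≠ a := fun h => ha (h ▸ hi)
        have h1 := hqT i hi
        simp only [hia, if_true, if_false]
        have h2 : ∑ j ∈ T, (if j = a then -p i else q i j) * X (v j) =
            ∑ j ∈ T, q i j * X (v j) := by
          refine Finset.sum_congr rfl fun j hj => ?_
          rw [if_neg (ne_of_mem_of_not_mem hj ha)]
        rw [h2, ← h1]
        ring

end MvPolynomial

/-! ### Linear substitutions in forms. -/

section CompLinear

variable {F σ : Type*} [Field F] [Fintype σ]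

theorem compLinear_X (A : Matrix σ σ F) (i : σ) :
    compLinear A (X i) = ∑ j, C (A i j) * X j := by
  simp [compLinear]

theorem compLinear_C (A : Matrix σ σ F) (a : F) : compLinear A (C a) = C a := by
  simp [compLinear, algebraMap_eq]

theorem compLinear_mul (A : Matrix σ σ F) (p q : MvPolynomial σ F) :
    compLinear A (p * q) = compLinear A p * compLinear A q :=
  map_mul (aeval _) p q

theorem compLinear_sum {ι : Type*} (A : Matrix σ σ F) (s : Finset ι) (p : ι → MvPolynomial σ F) :
    compLinear A (∑ i ∈ s, p i) = ∑ i ∈ s, compLinear A (p i) :=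
  map_sum (aeval _) p s

theorem compLinear_compLinear (A B : Matrix σ σ F) (p : MvPolynomial σ F) :
    compLinear A (compLinear B p) = compLinear (B * A) p := by
  have h : ((aeval fun i => ∑ j, C (A i j) * X j).comp
      (aeval fun i => ∑ j, C (B i j) * X j) : MvPolynomial σ F →ₐ[F] MvPolynomial σ F) =
      aeval fun i => ∑ j, C ((B * A) i j) * X j := by
    refine algHom_ext fun i => ?_
    simp only [AlgHom.comp_apply, aeval_X, map_sum, map_mul, algHom_C, Matrix.mul_apply,
      Finset.sum_mul, Finset.mul_sum, algebraMap_eq]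
    rw [Finset.sum_comm]
    simp only [mul_assoc]
  exact DFunLike.congr_fun h p

theorem compLinear_one [DecidableEq σ] (p : MvPolynomial σ F) : compLinear 1 p = p := by
  have h : (aeval (fun i => ∑ j, C ((1 : Matrix σ σ F) i j) * X j) :
      MvPolynomial σ F →ₐ[F] MvPolynomial σ F) = AlgHom.id F _ := by
    refine algHom_ext fun i => ?_
    simp [Matrix.one_apply, apply_ite (C : F → MvPolynomial σ F)]
  exact DFunLike.congr_fun h p

theorem MvPolynomial.IsHomogeneous.compLinear {p : MvPolynomial σ F} {d : ℕ}
    (hp : p.IsHomogeneous d) (A : Matrix σ σ F) : (compLinear A p).IsHomogeneous d := by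
  have := hp.aeval (fun i => ∑ j, C (A i j) * X j) (n := 1) fun i =>
    IsHomogeneous.sum _ _ _ fun j _ => isHomogeneous_C_mul_X _ _
  rwa [one_mul] at this

theorem MvPolynomial.IsHomogeneous.exists_eq_sum_C_mul_X {p : MvPolynomial σ F}
    (hp : p.IsHomogeneous 1) : ∃ a : σ → F, p = ∑ s, C (a s) * X s := by
  have h : p ∈ homogeneousSubmodule σ F 1 := hp
  rw [homogeneousSubmodule_one_eq_span_X, Submodule.mem_span_range_iff_exists_fun] at h
  obtain ⟨a, ha⟩ := h
  exact ⟨a, by simp [← ha, smul_eq_C_mul]⟩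

end CompLinear

/-! ### Reversible reductions of decompositions. -/

namespace SliceDecomp

section

variable {F σ : Type*} [Field F] [Fintype σ] {f : MvPolynomial σ F} {d r : ℕ}

theorem Equivalent.trans {D E G : SliceDecomp f d r} (h : Equivalent D E) (h' : Equivalent E G) :
    Equivalent D G :=
  ⟨Relation.ReflTransGen.trans h.1 h'.1, Relation.ReflTransGen.trans h'.2 h.2⟩

theorem Equivalent.of_reduces {D E : SliceDecomp f d r} (h : Reduces D E) (h' : Reduces E D) :
    Equivalent D E :=
  ⟨Relation.ReflTransGen.single h, Relation.ReflTransGen.single h'⟩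

/-- The inverse substitution also fixes `f` and undoes the reduction. Only the linear forms are
recorded, here and in `exists_equivalent_linear`: the cofactors are dealt with at the end by
`Reduces.of_injective`. -/
theorem exists_equivalent_compLinear [DecidableEq σ] (D : SliceDecomp f d r)
    {A B : Matrix σ σ F} (hAB : A * B = 1) (hA : compLinear A f = f) :
    ∃ E : SliceDecomp f d r, Equivalent D E ∧ ∀ i, E.α i = compLinear A (D.α i) := by
  have hBA (p : MvPolynomial σ F) : compLinear B (compLinear A p) = p := by
    rw [compLinear_compLinear, hAB, compLinear_one]
  have hB : compLinear B f = f := by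
    conv_lhs => rw [← hA, hBA]
  let E : SliceDecomp f d r :=
    { α := fun i => compLinear A (D.α i)
      g := fun i => compLinear A (D.g i)
      α_linear := fun i => (D.α_linear i).compLinear A
      g_form := fun i => (D.g_form i).compLinear A
      sum_eq := by
        conv_lhs => rw [← hA, D.sum_eq, compLinear_sum]
        simp only [compLinear_mul] }
  exact ⟨E, .of_reduces (.symmetric D E A hA (fun _ => rfl) fun _ => rfl)
    (.symmetric E D B hB (fun _ => (hBA _).symm) fun _ => (hBA _).symm), fun _ => rfl⟩

theorem exists_equivalent_linear (D : SliceDecomp f d r)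
    {c : Matrix (Fin r) (Fin r) F} (hc : IsUnit c) :
    ∃ E : SliceDecomp f d r, Equivalent D E ∧ ∀ i, E.α i = ∑ j, C (c i j) * D.α j := by
  have hdet := (Matrix.isUnit_iff_isUnit_det c).1 hc
  have key {a b : Matrix (Fin r) (Fin r) F} (hab : a * b = 1) (x : Fin r → MvPolynomial σ F)
      (i : Fin r) : x i = ∑ j, C (a i j) * ∑ k, C (b j k) * x k := by
    have h : ∀ k, ∑ j, C (a i j) * (C (b j k) * x k) =
        C ((1 : Matrix (Fin r) (Fin r) F) i k) * x k := by
      intro k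
      rw [← hab, Matrix.mul_apply, map_sum, Finset.sum_mul]
      simp only [C_mul, mul_assoc]
    simp only [Finset.mul_sum]
    rw [Finset.sum_comm]
    simp [h, Matrix.one_apply, apply_ite (C : F → MvPolynomial σ F)]
  have h1 := Matrix.nonsing_inv_mul c hdet
  have h2 : c.transpose * c⁻¹.transpose = 1 := by
    rw [← Matrix.transpose_mul, h1, Matrix.transpose_one]
  let E : SliceDecomp f d r :=
    { α := fun i => ∑ j, C (c i j) * D.α j
      g := fun j => ∑ i, C (c⁻¹ i j) * D.g i
      α_linear := fun i => IsHomogeneous.sum _ _ _ fun j _ => (D.α_linear j).C_mul _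
      g_form := fun j => IsHomogeneous.sum _ _ _ fun i _ => (D.g_form i).C_mul _
      sum_eq := by
        have h (β : Fin r → MvPolynomial σ F) : ∑ i, (∑ j, C (c⁻¹ i j) * β j) * D.g i =
            ∑ j, β j * ∑ i, C (c⁻¹ i j) * D.g i := by
          simp only [Finset.sum_mul, Finset.mul_sum]
          rw [Finset.sum_comm]
          exact Finset.sum_congr rfl fun j _ => Finset.sum_congr rfl fun i _ => by ring
        rw [← h]
        simp only [← key h1 D.α]
        exact D.sum_eq }
  exact ⟨E, .of_reduces (.linear D E c⁻¹ (key h1 D.α) fun _ => rfl)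
    (.linear E D c (fun _ => rfl) (key h2 D.g)), fun _ => rfl⟩

/-- The differences of the cofactors form a syzygy of distinct variables, so they come from an
alternating matrix. -/
theorem Reduces.of_injective {k : ℕ} {v : Fin r → σ} (hv : Function.Injective v)
    {D E : SliceDecomp f (k + 2) r} (hD : ∀ i, D.α i = X (v i)) (hE : ∀ i, E.α i = X (v i)) :
    Reduces D E := by
  obtain ⟨q, hq, hqd, hqs, h⟩ := exists_alternating_of_sum_X_mul_eq_zero hv k Finset.univ
    (fun i => D.g i - E.g i) (fun i => (D.g_form i).sub (E.g_form i)) (by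
      simp only [mul_sub, Finset.sum_sub_distrib]
      rw [sub_eq_zero]
      simp only [← hD]
      rw [← D.sum_eq]
      simp only [hD, ← hE]
      rw [← E.sum_eq])
  refine .syzygy D E q hq hqd hqs (fun i => by rw [hD, hE]) fun i => ?_
  have h1 := h i (Finset.mem_univ i)
  rw [← Finset.add_sum_erase _ _ (Finset.mem_univ i), hqd, zero_mul, zero_add] at h1
  simp only [hD, ← h1]
  ring

end

/-! ### Decompositions of the determinant. -/

section Det

open Matrix
open scoped Kronecker

variable {F : Type*} [Field F] {n r : ℕ}

theorem aeval_detPoly {K : Type*} [Field K] [Algebra F K] (M : Matrix (Fin n) (Fin n) K) :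
    aeval (fun s => M s.1 s.2) (detPoly F n) = M.det := by
  rw [detPoly, AlgHom.map_det]
  congr 1
  ext i j
  simp [mvPolynomialX]

theorem compLinear_kronecker_one (P : Matrix (Fin n) (Fin n) F) (i j : Fin n) :
    compLinear (P ⊗ₖ (1 : Matrix (Fin n) (Fin n) F)) (X (i, j)) = ∑ k, C (P i k) * X (k, j) := by
  rw [compLinear_X, Fintype.sum_prod_type]
  refine Finset.sum_congr rfl fun k _ => ?_
  simp [one_apply, apply_ite (C : F → MvPolynomial (Fin n × Fin n) F)]

theorem compLinear_kronecker_one_detPoly {P : Matrix (Fin n) (Fin n) F} (hP : P.det = 1) :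
    compLinear (P ⊗ₖ (1 : Matrix (Fin n) (Fin n) F)) (detPoly F n) = detPoly F n := by
  have h : (mvPolynomialX (Fin n) (Fin n) F).map
      (compLinear (P ⊗ₖ (1 : Matrix (Fin n) (Fin n) F))) =
      P.map C * mvPolynomialX (Fin n) (Fin n) F := by
    ext1 i j
    simp only [map_apply, mvPolynomialX_apply, compLinear_kronecker_one, mul_apply]
  calc _ = ((mvPolynomialX (Fin n) (Fin n) F).map
      (compLinear (P ⊗ₖ (1 : Matrix (Fin n) (Fin n) F)))).det := AlgHom.map_det (aeval _) _
    _ = C P.det * _ := by rw [h, det_mul, RingHom.map_det]; rfl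
    _ = _ := by rw [hP, C_1, one_mul]; rfl

/-- The endomorphism `M ↦ Mᵀ` of the space of matrices. -/
def transposeMatrix (F : Type*) [Field F] (n : ℕ) : Matrix (Fin n × Fin n) (Fin n × Fin n) F :=
  (1 : Matrix (Fin n × Fin n) (Fin n × Fin n) F).submatrix Prod.swap id

theorem transposeMatrix_mul_self : transposeMatrix F n * transposeMatrix F n = 1 := by
  ext s t
  rw [mul_apply, Finset.sum_eq_single s.swap] <;>
    simp +contextual [transposeMatrix, one_apply, eq_comm]

theorem compLinear_transposeMatrix_X (i j : Fin n) :
    compLinear (transposeMatrix F n) (X (i, j)) = X (j, i) := by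
  rw [compLinear_X, Finset.sum_eq_single (j, i)] <;>
    simp +contextual [transposeMatrix, one_apply, eq_comm]

theorem compLinear_transposeMatrix_detPoly :
    compLinear (transposeMatrix F n) (detPoly F n) = detPoly F n := by
  have h : (mvPolynomialX (Fin n) (Fin n) F).map (compLinear (transposeMatrix F n)) =
      (mvPolynomialX (Fin n) (Fin n) F)ᵀ := by
    ext1 i j
    simp only [map_apply, mvPolynomialX_apply, compLinear_transposeMatrix_X, transpose_apply]
  calc _ = ((mvPolynomialX (Fin n) (Fin n) F).map (compLinear (transposeMatrix F n))).det :=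
        AlgHom.map_det (aeval _) _
    _ = _ := by rw [h, det_transpose]; rfl

/-- The matrices over an extension field `K` at which the linear forms with coefficients `a`
vanish. -/
def zeroSpace (K : Type*) [Field K] [Algebra F K] (a : Fin r → Fin n × Fin n → F) :
    Submodule K (Matrix (Fin n) (Fin n) K) where
  carrier := {M | ∀ i, ∑ s, algebraMap F K (a i s) * M s.1 s.2 = 0}
  zero_mem' := by simp
  add_mem' := fun {M N} hM hN i => by
    have := congrArg₂ (· + ·) (hM i) (hN i)
    simpa [mul_add, Finset.sum_add_distrib] using this
  smul_mem' := fun c M hM i => by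
    have := congrArg (c * ·) (hM i)
    simpa [Finset.mul_sum, mul_left_comm] using this

theorem mem_zeroSpace {K : Type*} [Field K] [Algebra F K] {a : Fin r → Fin n × Fin n → F}
    {M : Matrix (Fin n) (Fin n) K} :
    M ∈ zeroSpace K a ↔ ∀ i, ∑ s, algebraMap F K (a i s) * M s.1 s.2 = 0 := Iff.rfl

theorem le_finrank_zeroSpace {K : Type*} [Field K] [Algebra F K]
    (a : Fin r → Fin n × Fin n → F) : n * n ≤ Module.finrank K (zeroSpace K a) + r := by
  let φ : Matrix (Fin n) (Fin n) K →ₗ[K] (Fin r → K) :=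
    { toFun := fun M i => ∑ s, algebraMap F K (a i s) * M s.1 s.2
      map_add' := fun M N => by ext i; simp [mul_add, Finset.sum_add_distrib]
      map_smul' := fun c M => by ext i; simp [Finset.mul_sum, mul_left_comm] }
  have hφ : LinearMap.ker φ = zeroSpace K a := by
    ext M
    exact funext_iff
  have h1 := φ.finrank_range_add_finrank_ker
  have h2 := Submodule.finrank_le (LinearMap.range φ)
  rw [hφ] at h1
  simp [Module.finrank_matrix] at h1 h2
  omega

theorem HasLeftKernel.of_zeroSpace {K : Type*} [Field K] [Algebra F K]
    {a : Fin r → Fin n × Fin n → F} (h : HasLeftKernel (zeroSpace K a)) :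
    HasLeftKernel (zeroSpace F a) := by
  obtain ⟨w, hw, h⟩ := h
  obtain ⟨i, hi⟩ := Function.ne_iff.1 hw
  -- An `F`-linear functional on `K` that does not kill `w i` carries `w` to a nonzero vector over
  -- `F`, and preserves linear relations with coefficients in `F`.
  obtain ⟨φ, hφ⟩ : ∃ φ : Module.Dual F K, φ (w i) ≠ 0 := by
    by_contra! h0
    exact hi ((Module.forall_dual_apply_eq_zero_iff F (w i)).1 h0)
  refine ⟨fun i => φ (w i), fun h0 => hφ (congrFun h0 i), fun M hM => ?_⟩
  have hM' : M.map (algebraMap F K) ∈ zeroSpace K a := fun i => by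
    have := congrArg (algebraMap F K) (hM i)
    simpa using this
  ext j
  have h1 : ∑ i, M i j • w i = 0 :=
    (Finset.sum_congr rfl fun i _ => by rw [Algebra.smul_def, mul_comm]; rfl).trans
      (congrFun (h _ hM') j)
  simpa [vecMul, dotProduct, mul_comm] using congrArg φ h1

theorem HasRightKernel.of_zeroSpace {K : Type*} [Field K] [Algebra F K]
    {a : Fin r → Fin n × Fin n → F} (h : HasRightKernel (zeroSpace K a)) :
    HasRightKernel (zeroSpace F a) := by
  obtain ⟨w, hw, h⟩ := h
  obtain ⟨i, hi⟩ := Function.ne_iff.1 hw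
  obtain ⟨φ, hφ⟩ : ∃ φ : Module.Dual F K, φ (w i) ≠ 0 := by
    by_contra! h0
    exact hi ((Module.forall_dual_apply_eq_zero_iff F (w i)).1 h0)
  refine ⟨fun i => φ (w i), fun h0 => hφ (congrFun h0 i), fun M hM => ?_⟩
  have hM' : M.map (algebraMap F K) ∈ zeroSpace K a := fun i => by
    have := congrArg (algebraMap F K) (hM i)
    simpa using this
  ext j
  have := congrArg φ (congrFun (h _ hM') j)
  simpa [mulVec, dotProduct, ← Algebra.smul_def] using this

theorem hasKernel_zeroSpace (D : SliceDecomp (detPoly F n) n r) (hr : r ≤ n)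
    {a : Fin r → Fin n × Fin n → F} (ha : ∀ i, D.α i = ∑ s, C (a i s) * X s) :
    HasLeftKernel (zeroSpace F a) ∨ HasRightKernel (zeroSpace F a) := by
  have h := singularSpacesHaveKernel (AlgebraicClosure F) n (zeroSpace (AlgebraicClosure F) a)
    ((le_finrank_zeroSpace a).trans (Nat.add_le_add_left hr _)) (fun M hM => by
      rw [← aeval_detPoly (F := F), D.sum_eq, map_sum]
      refine Finset.sum_eq_zero fun i _ => ?_
      rw [map_mul, ha i]
      have := hM i
      simp [this])
  exact h.imp HasLeftKernel.of_zeroSpace HasRightKernel.of_zeroSpace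

theorem le_of_sliceDecomp (D : SliceDecomp (detPoly F n) n r) : n ≤ r := by
  by_contra! hr
  choose a ha using fun i => (D.α_linear i).exists_eq_sum_C_mul_X
  have h1 := le_finrank_zeroSpace (K := F) a
  have h2 : Module.finrank F (zeroSpace F a) + n ≤ n * n := by
    rcases hasKernel_zeroSpace D hr.le ha with h | h <;> simpa using h.finrank_add_card_le
  omega

/-- The `n` entries of `w ᵥ* M` vanish wherever all `α i` do, so they are combinations of the `α i`.
Since they are independent, the coefficient matrix is invertible. -/
theorem exists_equivalent_of_hasLeftKernel (D : SliceDecomp (detPoly F n) n n)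
    {a : Fin n → Fin n × Fin n → F} (ha : ∀ i, D.α i = ∑ s, C (a i s) * X s)
    {w : Fin n → F} (hw : w ≠ 0) (hwa : ∀ M ∈ zeroSpace F a, w ᵥ* M = 0) :
    ∃ E : SliceDecomp (detPoly F n) n n, Equivalent D E ∧
      ∀ j, E.α j = ∑ i, C (w i) * X (i, j) := by
  let L (b : Fin n × Fin n → F) : Matrix (Fin n) (Fin n) F →ₗ[F] F :=
    { toFun := fun M => ∑ s, b s * M s.1 s.2
      map_add' := fun M N => by simp [mul_add, Finset.sum_add_distrib]
      map_smul' := fun c M => by simp [Finset.mul_sum, mul_left_comm] }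
  have hLs (b : Fin n × Fin n → F) (s : Fin n × Fin n) : L b (single s.1 s.2 1) = b s := by
    change ∑ t, b t * single s.1 s.2 1 t.1 t.2 = b s
    rw [Finset.sum_eq_single s] <;> simp +contextual [Prod.ext_iff, eq_comm]
  let W (j : Fin n) (s : Fin n × Fin n) : F := if s.2 = j then w s.1 else 0
  have hspan (j : Fin n) : ∃ c : Fin n → F, ∑ t, c t • L (a t) = L (W j) := by
    rw [← Submodule.mem_span_range_iff_exists_fun]
    refine mem_span_of_iInf_ker_le_ker fun M hM => ?_
    have hM' : M ∈ zeroSpace F a := fun i => (Submodule.mem_iInf _).1 hM i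
    have := congrFun (hwa M hM') j
    rw [LinearMap.mem_ker]
    change ∑ s, W j s * M s.1 s.2 = 0
    simpa [W, Fintype.sum_prod_type, vecMul, dotProduct] using this
  choose c hc using hspan
  have hc' (j : Fin n) (s : Fin n × Fin n) : ∑ t, c j t * a t s = W j s := by
    have := congrArg (fun φ => φ (single s.1 s.2 1)) (hc j)
    simpa [LinearMap.sum_apply, hLs] using this
  have hunit : IsUnit (Matrix.of c) := by
    rw [← vecMul_injective_iff_isUnit]
    refine (injective_iff_map_eq_zero (vecMulLinear (Matrix.of c))).2 fun v hv => ?_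
    obtain ⟨i, hi⟩ := Function.ne_iff.1 hw
    ext l
    have h1 : ∑ j, v j * ∑ t, c j t * a t (i, l) = 0 := by
      simp only [Finset.mul_sum]
      rw [Finset.sum_comm]
      refine Finset.sum_eq_zero fun t _ => ?_
      have := congrFun hv t
      simp only [← mul_assoc, ← Finset.sum_mul]
      rw [show ∑ j, v j * c j t = 0 from this, zero_mul]
    simp only [hc', W] at h1
    simpa [show w i ≠ 0 from hi] using h1
  obtain ⟨E, hDE, hE⟩ := D.exists_equivalent_linear hunit
  refine ⟨E, hDE, fun j => ?_⟩
  rw [hE]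
  simp only [ha, Finset.mul_sum, ← mul_assoc, ← C_mul, of_apply]
  rw [Finset.sum_comm]
  simp only [← Finset.sum_mul, ← map_sum, hc', W]
  simp [Fintype.sum_prod_type, apply_ite (C : F → MvPolynomial (Fin n × Fin n) F)]

theorem equivalent_laplaceDecomp_of_hasLeftKernel {k : ℕ}
    (D : SliceDecomp (detPoly F (k + 2)) (k + 2) (k + 2))
    {a : Fin (k + 2) → Fin (k + 2) × Fin (k + 2) → F} (ha : ∀ i, D.α i = ∑ s, C (a i s) * X s)
    (h : HasLeftKernel (zeroSpace F a)) : Equivalent D (laplaceDecomp F (k + 1)) := by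
  obtain ⟨w, hw, hwa⟩ := h
  obtain ⟨E, hDE, hE⟩ := D.exists_equivalent_of_hasLeftKernel ha hw hwa
  obtain ⟨Q, hQ, hQw⟩ := exists_det_eq_one_row_zero_eq hw
  have hQ' : IsUnit Q.det := by simp [hQ]
  obtain ⟨G, hEG, hG⟩ := E.exists_equivalent_compLinear
    (A := Q⁻¹ ⊗ₖ (1 : Matrix (Fin (k + 2)) (Fin (k + 2)) F)) (B := Q ⊗ₖ 1)
    (by rw [← mul_kronecker_mul, nonsing_inv_mul _ hQ', one_mul, one_kronecker_one])
    (compLinear_kronecker_one_detPoly (by rw [det_nonsing_inv, hQ, Ring.inverse_one]))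
  have hGX (j : Fin (k + 2)) : G.α j = X (0, j) := by
    have hwQ (l : Fin (k + 2)) : ∑ i, w i * Q⁻¹ i l = if 0 = l then 1 else 0 := by
      rw [← one_apply, ← mul_nonsing_inv Q hQ', mul_apply, hQw]
    rw [hG, hE, compLinear_sum]
    simp only [compLinear_mul, compLinear_C, compLinear_kronecker_one, Finset.mul_sum,
      ← mul_assoc, ← C_mul]
    rw [Finset.sum_comm]
    simp only [← Finset.sum_mul, ← map_sum, hwQ]
    simp [apply_ite (C : F → MvPolynomial (Fin (k + 2) × Fin (k + 2)) F)]
  have hinj : Function.Injective fun j : Fin (k + 2) => ((0 : Fin (k + 2)), j) :=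
    Prod.mk_right_injective 0
  exact (hDE.trans hEG).trans (.of_reduces (.of_injective hinj hGX fun _ => rfl)
    (.of_injective hinj (fun _ => rfl) hGX))

theorem equivalent_laplaceDecomp {k : ℕ} (D : SliceDecomp (detPoly F (k + 2)) (k + 2) (k + 2)) :
    Equivalent D (laplaceDecomp F (k + 1)) := by
  choose a ha using fun i => (D.α_linear i).exists_eq_sum_C_mul_X
  rcases hasKernel_zeroSpace D le_rfl ha with h | h
  · exact D.equivalent_laplaceDecomp_of_hasLeftKernel ha h
  obtain ⟨E, hDE, hE⟩ := D.exists_equivalent_compLinear transposeMatrix_mul_self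
    compLinear_transposeMatrix_detPoly
  -- Transposition swaps the indices of the coefficients and turns the right kernel vector into a
  -- left one.
  refine hDE.trans (E.equivalent_laplaceDecomp_of_hasLeftKernel (a := fun i s => a i s.swap)
    (fun i => ?_) ?_)
  · rw [hE, ha, compLinear_sum, ← (Equiv.prodComm (Fin (k + 2)) (Fin (k + 2))).sum_comp]
    refine Finset.sum_congr rfl fun s _ => ?_
    rw [compLinear_mul, compLinear_C]
    exact congrArg _ (compLinear_transposeMatrix_X s.2 s.1)
  · convert hasLeftKernel_transposeSpace.2 h using 1
    ext M
    rw [mem_transposeSpace, mem_zeroSpace, mem_zeroSpace]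
    refine forall_congr' fun i => ?_
    rw [← (Equiv.prodComm (Fin (k + 2)) (Fin (k + 2))).sum_comp]
    rfl

end Det

end SliceDecomp

/-- Here `m + 1` is the size of the matrices. -/
theorem theorem2p4 (F : Type*) [Field F] (m : ℕ) (hm : 2 ≤ m + 1) :
    sliceRank (detPoly F (m + 1)) (m + 1) = ((m + 1 : ℕ) : ℕ∞) ∧
      ∀ D : SliceDecomp (detPoly F (m + 1)) (m + 1) (m + 1),
        SliceDecomp.Equivalent D (laplaceDecomp F m) := by
  obtain ⟨k, rfl⟩ : ∃ k, m = k + 1 := ⟨m - 1, by omega⟩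
  refine ⟨le_antisymm (iInf₂_le _ ⟨laplaceDecomp F (k + 1)⟩) (le_iInf₂ fun r hr => ?_),
    fun D => D.equivalent_laplaceDecomp⟩
  exact Nat.cast_le.2 (SliceDecomp.le_of_sliceDecomp hr.some)
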